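/- Let $\mathbb N=\{1,2,\dots\}$, let $c_{00}(\mathbb N)$ be the real vector space of finitely supported real sequences with unit vector basis $(e_i)_{i\in\mathbb N}$, and for $f,x\in c_{00}(\mathbb N)$ put $f(x)=\sum_i f_ix_i$. Write $f<g$ if every element of $\operatorname{supp} f$ is smaller than every element of $\operatorname{supp} g$. Let $G\subset c_{00}(\mathbb N)$. (i) An $\alpha$-average of $G$ of size $n$ is a vector $\frac1n(f_1+\cdots+f_d)$ with $1\le d\le n$ and $f_1<\cdots<f_d$ in $G$. (ii) A Schreier functional of $G$ is a vector $\frac12(\alpha_1+\cdots+\alpha_k)$, $k\ge 1$, where, for some $s_1<\cdots<s_k$, each $\alpha_i$ is an $\alpha$-average of $G$ of size $s_i$, $\alpha_1<\cdots<\alpha_k$, $k\le\min\operatorname{supp}\alpha_1$, and $s_i>\max\operatorname{supp}\alpha_{i-1}$ for $1<i\le k$. Let $W_{0,1}$ be the smallest subset $W$ of $c_{00}(\mathbb N)$ that satisfies $W=-W$ and contains every $e_i$, every $\alpha$-average of $W$ and every Schreier functional of $W$. Let $\|x\|=\sup\{f(x):f\in W_{0,1}\}$ for $x\in c_{00}(\mathbb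 N)$, and let $\mathfrak X^{1/2}_{0,1}$ be the completion of $(c_{00}(\mathbb N),\|\cdot\|)$. **Corollary.** The Banach space $\mathfrak X^{1/2}_{0,1}$ is reflexive, that is, the canonical embedding of $\mathfrak X^{1/2}_{0,1}$ into its bidual is surjective. -/

import Mathlib

noncomputable section

namespace SpreadingSpace

/-- The vector space `c₀₀(ℕ)` of finitely supported real sequences, indexed by the positive
integers. It carries no norm here. -/
abbrev C00 : Type := ℕ+ →₀ ℝ

/-- `f(x)`: the usual inner product of two finitely supported sequences. -/
def pairing (f x : C00) : ℝ := f.sum fun i a => a * x i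

/-- `f < g`: the support of `f` lies before the support of `g`
(with `max ∅ = 0` and `min ∅ = ∞`). -/
def Before (f g : C00) : Prop := ∀ i ∈ f.support, ∀ j ∈ g.support, i < j

/-- `f₁ < f₂ < ⋯ < f_d`. -/
def Successive {d : ℕ} (f : Fin d → C00) : Prop := ∀ i j : Fin d, i < j → Before (f i) (f j)

/-- `a` is an `α`-average of `G` of size `n`: `a = (1/n)(f₁ + ⋯ + f_d)` with `f₁ < ⋯ < f_d` in `G`
and `1 ≤ d ≤ n`. -/
def IsAlphaAverage (G : Set C00) (n : ℕ) (a : C00) : Prop :=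
  ∃ (d : ℕ) (f : Fin d → C00), 1 ≤ d ∧ d ≤ n ∧ (∀ i, f i ∈ G) ∧ Successive f ∧
    a = (1 / (n : ℝ)) • ∑ i, f i

/-- `k ≤ min supp a₁` for a sequence `a₁ < ⋯ < a_k`. -/
def Admissible {k : ℕ} (a : Fin k → C00) : Prop :=
  Successive a ∧ ∀ (h : 0 < k), ∀ m ∈ (a ⟨0, h⟩).support, k ≤ (m : ℕ)

/-- The sequence `a₁ < ⋯ < a_k`, where `a_i` has size `s i`, is very fast growing: the sizes
increase strictly and each size exceeds the maximum of the support of the preceding vector. -/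
def VeryFastGrowing {k : ℕ} (a : Fin k → C00) (s : Fin k → ℕ) : Prop :=
  Successive a ∧ StrictMono s ∧
    ∀ i j : Fin k, (i : ℕ) + 1 = j → ∀ m ∈ (a i).support, (m : ℕ) < s j

/-- `f` is a Schreier functional of `G`: `f = (1/2)(a₁ + ⋯ + a_k)` for an admissible and very fast
growing sequence of `α`-averages of `G`. -/
def IsSchreierFunctional (G : Set C00) (f : C00) : Prop :=
  ∃ (k : ℕ) (a : Fin k → C00) (s : Fin k → ℕ), 1 ≤ k ∧ (∀ i, IsAlphaAverage G (s i) (a i)) ∧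
    Admissible a ∧ VeryFastGrowing a s ∧ f = (1 / 2 : ℝ) • ∑ i, a i

/-- `W` is symmetric, contains the unit vectors, its `α`-averages and its Schreier functionals. -/
structure IsSaturated (W : Set C00) : Prop where
  neg_mem : ∀ f ∈ W, -f ∈ W
  unit_mem : ∀ i : ℕ+, Finsupp.single i (1 : ℝ) ∈ W
  average_mem : ∀ (n : ℕ) (a : C00), IsAlphaAverage W n a → a ∈ W
  schreier_mem : ∀ f : C00, IsSchreierFunctional W f → f ∈ W

/-- The norming set `W_{0,1}`: the smallest saturated subset of `c₀₀(ℕ)`. -/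
def W01 : Set C00 := ⋂₀ {W | IsSaturated W}

theorem IsAlphaAverage.mono {G H : Set C00} (h : G ⊆ H) {n : ℕ} {a : C00}
    (ha : IsAlphaAverage G n a) : IsAlphaAverage H n a := by
  obtain ⟨d, f, h1, h2, h3, h4, h5⟩ := ha
  exact ⟨d, f, h1, h2, fun i => h (h3 i), h4, h5⟩

theorem IsSchreierFunctional.mono {G H : Set C00} (h : G ⊆ H) {f : C00}
    (hf : IsSchreierFunctional G f) : IsSchreierFunctional H f := by
  obtain ⟨k, a, s, h1, h2, h3, h4, h5⟩ := hf
  exact ⟨k, a, s, h1, fun i => (h2 i).mono h, h3, h4, h5⟩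

theorem isLeast_W01 : IsLeast {W | IsSaturated W} W01 := by
  refine ⟨⟨?_, ?_, ?_, ?_⟩, fun W hW => Set.sInter_subset_of_mem hW⟩
  · exact fun f hf W hW => hW.neg_mem f (hf W hW)
  · exact fun i W hW => hW.unit_mem i
  · exact fun n a ha W hW => hW.average_mem n a (ha.mono (Set.sInter_subset_of_mem hW))
  · exact fun f hf W hW => hW.schreier_mem f (hf.mono (Set.sInter_subset_of_mem hW))

theorem abs_sum_le_of_successive {d : ℕ} (f : Fin d → C00) (hs : Successive f)
    (h : ∀ j i, |f j i| ≤ 1) (i : ℕ+) : |(∑ j, f j) i| ≤ 1 := by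
  rw [Finsupp.finsetSum_apply]
  by_cases hz : ∀ j, f j i = 0
  · simp [hz]
  · push Not at hz
    obtain ⟨j, hj⟩ := hz
    rw [Finset.sum_eq_single j]
    · exact h j i
    · intro l _ hl
      by_contra hne
      rcases lt_or_gt_of_ne hl with hlt | hlt
      · exact lt_irrefl _ (hs l j hlt i (Finsupp.mem_support_iff.2 hne) i
          (Finsupp.mem_support_iff.2 hj))
      · exact lt_irrefl _ (hs j l hlt i (Finsupp.mem_support_iff.2 hj) i
          (Finsupp.mem_support_iff.2 hne))
    · simp

theorem abs_average_le {G : Set C00} (hG : ∀ f ∈ G, ∀ i, |f i| ≤ 1) {n : ℕ} {a : C00}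
    (ha : IsAlphaAverage G n a) (i : ℕ+) : |a i| ≤ 1 := by
  obtain ⟨d, f, h1, h2, h3, h4, rfl⟩ := ha
  have hn : (1 : ℝ) ≤ n := by exact_mod_cast h1.trans h2
  have h := abs_sum_le_of_successive f h4 (fun j => hG _ (h3 j)) i
  rw [Finsupp.smul_apply, smul_eq_mul, abs_mul, abs_of_nonneg (by positivity)]
  exact mul_le_one₀ ((div_le_one (by linarith)).2 hn) (abs_nonneg _) h

theorem abs_apply_le_of_mem_W01 {f : C00} (hf : f ∈ W01) (i : ℕ+) : |f i| ≤ 1 := by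
  have key : IsSaturated {f : C00 | ∀ i, |f i| ≤ 1} := by
    refine ⟨fun f hf i => by simpa using hf i, fun j i => ?_, fun n a ha i => ?_, fun f hf i => ?_⟩
    · by_cases h : j = i <;> simp [h]
    · exact abs_average_le (fun _ h => h) ha i
    · obtain ⟨k, a, s, -, h2, h3, -, rfl⟩ := hf
      have h := abs_sum_le_of_successive a h3.1
        (fun j i => abs_average_le (fun _ h => h) (h2 j) i) i
      rw [Finsupp.smul_apply, smul_eq_mul, abs_mul, abs_of_nonneg (by norm_num)]
      linarith
  exact hf _ key i

theorem pairing_eq (f x : C00) : pairing f x = x.sum fun i b => f i * b := by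
  have h1 : pairing f x = ∑ i ∈ f.support ∪ x.support, f i * x i := by
    refine Finset.sum_subset Finset.subset_union_left fun i _ h => ?_
    simp [Finsupp.notMem_support_iff.1 h]
  have h2 : (x.sum fun i b => f i * b) = ∑ i ∈ f.support ∪ x.support, f i * x i := by
    refine Finset.sum_subset Finset.subset_union_right fun i _ h => ?_
    simp [Finsupp.notMem_support_iff.1 h]
  rw [h1, h2]

theorem pairing_add (f x y : C00) : pairing f (x + y) = pairing f x + pairing f y := by
  simp [pairing, Finsupp.sum, mul_add, Finset.sum_add_distrib]

theorem pairing_smul (f : C00) (c : ℝ) (x : C00) : pairing f (c • x) = c * pairing f x := by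
  simp only [pairing, Finsupp.sum, Finsupp.smul_apply, smul_eq_mul, Finset.mul_sum]
  exact Finset.sum_congr rfl fun i _ => by ring

theorem pairing_neg_left (f x : C00) : pairing (-f) x = -pairing f x := by
  simp [pairing, Finsupp.sum]

/-- The functional `‖x‖ = sup {f(x) : f ∈ W_{0,1}}`; the set is bounded, see
`bddAbove_pairing`. -/
def normW (x : C00) : ℝ := sSup {r | ∃ f ∈ W01, r = pairing f x}

theorem bddAbove_pairing (x : C00) : BddAbove {r | ∃ f ∈ W01, r = pairing f x} := by
  refine ⟨∑ i ∈ x.support, |x i|, ?_⟩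
  rintro r ⟨f, hf, rfl⟩
  rw [pairing_eq]
  refine Finset.sum_le_sum fun i _ => (le_abs_self _).trans ?_
  rw [abs_mul]
  exact mul_le_of_le_one_left (abs_nonneg _) (abs_apply_le_of_mem_W01 hf i)

theorem pairing_le_normW {f : C00} (hf : f ∈ W01) (x : C00) : pairing f x ≤ normW x :=
  le_csSup (bddAbove_pairing x) ⟨f, hf, rfl⟩

theorem normW_le {x : C00} {c : ℝ} (h : ∀ f ∈ W01, pairing f x ≤ c) : normW x ≤ c := by
  refine csSup_le ⟨_, _, isLeast_W01.1.unit_mem 1, rfl⟩ ?_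
  rintro r ⟨f, hf, rfl⟩
  exact h f hf

theorem abs_pairing_le_normW {f : C00} (hf : f ∈ W01) (x : C00) : |pairing f x| ≤ normW x := by
  refine abs_le'.2 ⟨pairing_le_normW hf x, ?_⟩
  rw [← pairing_neg_left]
  exact pairing_le_normW (isLeast_W01.1.neg_mem f hf) x

theorem abs_apply_le_normW (x : C00) (i : ℕ+) : |x i| ≤ normW x := by
  have h := abs_pairing_le_normW (isLeast_W01.1.unit_mem i) x
  simpa [pairing] using h

theorem normW_nonneg (x : C00) : 0 ≤ normW x := (abs_nonneg _).trans (abs_apply_le_normW x 1)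

theorem normW_add_le (x y : C00) : normW (x + y) ≤ normW x + normW y :=
  normW_le fun f hf => by
    rw [pairing_add]
    exact add_le_add (pairing_le_normW hf x) (pairing_le_normW hf y)

theorem normW_smul_le (c : ℝ) (x : C00) : normW (c • x) ≤ |c| * normW x :=
  normW_le fun f hf => by
    rw [pairing_smul]
    refine (le_abs_self _).trans ?_
    rw [abs_mul]
    exact mul_le_mul_of_nonneg_left (abs_pairing_le_normW hf x) (abs_nonneg _)

theorem normW_smul (c : ℝ) (x : C00) : normW (c • x) = |c| * normW x := by
  refine le_antisymm (normW_smul_le c x) ?_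
  rcases eq_or_ne c 0 with rfl | hc
  · simpa using normW_nonneg 0
  · have h := normW_smul_le c⁻¹ (c • x)
    rw [smul_smul, inv_mul_cancel₀ hc, one_smul, abs_inv] at h
    have hc' : 0 < |c| := abs_pos.2 hc
    calc |c| * normW x ≤ |c| * (|c|⁻¹ * normW (c • x)) := mul_le_mul_of_nonneg_left h hc'.le
      _ = normW (c • x) := by rw [← mul_assoc, mul_inv_cancel₀ hc'.ne', one_mul]

theorem eq_zero_of_normW {x : C00} (h : normW x = 0) : x = 0 := by
  ext i
  exact abs_nonpos_iff.1 (h ▸ abs_apply_le_normW x i)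

/-- A copy of `c₀₀(ℕ)`, to carry the norm `normW`. -/
def NormedC00 : Type := C00

instance : AddCommGroup NormedC00 := inferInstanceAs (AddCommGroup C00)

instance : Module ℝ NormedC00 := inferInstanceAs (Module ℝ C00)

instance : Norm NormedC00 := ⟨normW⟩

theorem normCore : NormedSpace.Core ℝ NormedC00 where
  norm_nonneg := normW_nonneg
  norm_smul := normW_smul
  norm_triangle := normW_add_le
  norm_eq_zero_iff x := ⟨eq_zero_of_normW, fun h => by
    have h0 := normW_smul 0 (0 : C00)
    rw [zero_smul, abs_zero, zero_mul] at h0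
    rw [h]
    exact h0⟩

instance : NormedAddCommGroup NormedC00 := NormedAddCommGroup.ofCore normCore

instance : NormedSpace ℝ NormedC00 := NormedSpace.ofCore normCore

/-- The Banach space `𝔛^{1/2}_{0,1}`: the completion of `(c₀₀(ℕ), ‖·‖)`. -/
abbrev XHalf01 : Type := UniformSpace.Completion NormedC00

end SpreadingSpace

/-- A real normed space is reflexive if the canonical map into its bidual is onto. -/
def IsReflexiveSpace (X : Type*) [NormedAddCommGroup X] [NormedSpace ℝ X] : Prop :=
  Function.Surjective (NormedSpace.inclusionInDoubleDual ℝ X)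

end

noncomputable section

namespace SpreadingSpace

open Filter Topology

/-! The argument is James's: the unit vectors form a basis that is both boundedly complete and
shrinking. Both properties come from Schreier functionals. Bounded completeness
(`exists_forall_mem_W01_le`): if a functional stayed above `δ` on elements of the norming set
arbitrarily far out, long averages of these would combine into Schreier functionals `(1/2)(a₁ + ⋯ +
a_k)` on which it is at least `kδ/2`, with `k` arbitrary. Shrinking (`exists_forall_abs_le`): if the
tail norms of a functional `L` had infimum `θ > 0`, a nearly extremal block sequence would give a
vector `x` and an average `y` of later blocks with `L (x + y)` close to `2θ`. But a Schreier
functional that meets `x` has at most `max supp x` averages, so the factor `1/2` costs it a fixed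
proportion on a long enough average, and `‖x + y‖ ≤ 7/4` (`normW_add_average_le`). Given `Φ` in the
bidual, the first property makes the truncations of `(Φ (coord i))` converge to some `z`; by the
second, finitely supported functionals are dense in the dual, so `Φ` is evaluation at `z`. -/

theorem isSaturated_W01 : IsSaturated W01 := isLeast_W01.1

/-- Induction over `W01`: a symmetric property of the unit vectors that passes to `α`-averages and
Schreier functionals holds throughout `W01`. -/
theorem W01_induction {P : C00 → Prop} (hneg : ∀ f ∈ W01, P f → P (-f))
    (hunit : ∀ i : ℕ+, P (Finsupp.single i 1))
    (havg : ∀ n a, IsAlphaAverage {f | f ∈ W01 ∧ P f} n a → P a)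
    (hsch : ∀ f, IsSchreierFunctional {f | f ∈ W01 ∧ P f} f → P f) {f : C00} (hf : f ∈ W01) :
    P f := by
  have key : IsSaturated {f | f ∈ W01 ∧ P f} :=
    ⟨fun f hf => ⟨isSaturated_W01.neg_mem f hf.1, hneg f hf.1 hf.2⟩,
      fun i => ⟨isSaturated_W01.unit_mem i, hunit i⟩,
      fun n a ha => ⟨isSaturated_W01.average_mem n a (ha.mono fun _ h => h.1), havg n a ha⟩,
      fun f hf => ⟨isSaturated_W01.schreier_mem f (hf.mono fun _ h => h.1), hsch f hf⟩⟩
  exact (hf _ key).2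

/-! ### Supports and restrictions in the norming set -/

theorem Successive.sum_apply_of_mem_support {d : ℕ} {f : Fin d → C00} (hs : Successive f)
    {j : Fin d} {i : ℕ+} (hi : i ∈ (f j).support) : (∑ l, f l) i = f j i := by
  rw [Finsupp.finsetSum_apply]
  refine Finset.sum_eq_single j (fun l _ hl => ?_) (by simp)
  by_contra hne
  rcases lt_or_gt_of_ne hl with hlt | hlt
  · exact lt_irrefl _ (hs l j hlt i (Finsupp.mem_support_iff.2 hne) i hi)
  · exact lt_irrefl _ (hs j l hlt i hi i (Finsupp.mem_support_iff.2 hne))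

theorem Successive.sum_ne_zero {d : ℕ} {f : Fin d → C00} (hs : Successive f) (j : Fin d)
    (hj : f j ≠ 0) : ∑ l, f l ≠ 0 := by
  obtain ⟨i, hi⟩ := Finsupp.support_nonempty_iff.2 hj
  intro h
  have h1 := hs.sum_apply_of_mem_support hi
  rw [h] at h1
  exact Finsupp.mem_support_iff.1 hi h1.symm

theorem IsAlphaAverage.ne_zero {G : Set C00} (hG : ∀ f ∈ G, f ≠ 0) {n : ℕ} {a : C00}
    (ha : IsAlphaAverage G n a) : a ≠ 0 := by
  obtain ⟨d, f, h1, h2, h3, h4, rfl⟩ := ha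
  have hn : (n : ℝ) ≠ 0 := Nat.cast_ne_zero.2 (by omega)
  exact smul_ne_zero (by simpa using hn) (h4.sum_ne_zero ⟨0, h1⟩ (hG _ (h3 _)))

/-- Successive vectors cannot cancel, and averages have at least one term. This matters because
admissibility only constrains the support of the first average, and would be vacuous if that were
zero. -/
theorem ne_zero_of_mem_W01 {f : C00} (hf : f ∈ W01) : f ≠ 0 := by
  refine W01_induction (P := fun f => f ≠ 0) (fun f _ h => neg_ne_zero.2 h) (fun i => by simp)
    (fun n a ha => ha.ne_zero fun _ h => h.2) (fun f hf => ?_) hf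
  obtain ⟨k, a, s, h1, h2, -, h4, rfl⟩ := hf
  exact smul_ne_zero (by norm_num) (h4.1.sum_ne_zero ⟨0, h1⟩ ((h2 _).ne_zero fun _ h => h.2))

theorem Admissible.le_of_mem_support {k : ℕ} {a : Fin k → C00} (ha : Admissible a)
    (h0 : ∀ q, a q ≠ 0) {q : Fin k} {m : ℕ+} (hm : m ∈ (a q).support) : k ≤ m := by
  have hk : 0 < k := q.pos
  rcases (Nat.zero_le (q : ℕ)).eq_or_lt with h | h
  · have hq : q = ⟨0, hk⟩ := Fin.ext h.symm
    exact ha.2 hk m (hq ▸ hm)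
  · obtain ⟨i, hi⟩ := Finsupp.support_nonempty_iff.2 (h0 ⟨0, hk⟩)
    exact (ha.2 hk i hi).trans (PNat.coe_le_coe _ _ |>.2 (ha.1 ⟨0, hk⟩ q h i hi m hm).le)

theorem exists_orderEmb_nonzero {d : ℕ} (g : Fin d → C00) :
    ∃ (m : ℕ) (e : Fin m ↪o Fin d), (∀ j, g (e j) ≠ 0) ∧ ∑ i, g i = ∑ j, g (e j) := by
  classical
  let T : Finset (Fin d) := Finset.univ.filter fun i => g i ≠ 0
  refine ⟨T.card, T.orderEmbOfFin rfl, fun j => ?_, ?_⟩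
  · exact (Finset.mem_filter.1 (T.orderEmbOfFin_mem rfl j)).2
  · have h1 : ∑ i, g i = ∑ i ∈ T, g i :=
      (Finset.sum_filter_ne_zero _).symm
    rw [h1]
    conv_lhs => rw [← T.map_orderEmbOfFin_univ rfl]
    rw [Finset.sum_map]
    rfl

theorem OrderEmbedding.card_le {m d : ℕ} (e : Fin m ↪o Fin d) : m ≤ d := by
  simpa using Fintype.card_le_of_injective e e.injective

theorem Successive.comp_filter {d m : ℕ} {f : Fin d → C00} (hs : Successive f) (e : Fin m ↪o Fin d)
    (S : ℕ+ → Prop) [DecidablePred S] : Successive fun j => (f (e j)).filter S := by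
  intro i j hij x hx y hy
  exact hs _ _ (e.lt_iff_lt.2 hij) x (Finset.mem_filter.1 hx).1 y (Finset.mem_filter.1 hy).1

theorem IsAlphaAverage.filter {G H : Set C00} (S : ℕ+ → Prop) [DecidablePred S]
    (hG : ∀ f ∈ G, f.filter S ∈ H ∨ f.filter S = 0) {n : ℕ} {a : C00}
    (ha : IsAlphaAverage G n a) : IsAlphaAverage H n (a.filter S) ∨ a.filter S = 0 := by
  obtain ⟨d, f, h1, h2, h3, h4, rfl⟩ := ha
  obtain ⟨m, e, he, hsum⟩ := exists_orderEmb_nonzero fun i => (f i).filter S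
  rw [Finsupp.filter_smul, Finsupp.filter_sum, hsum]
  rcases Nat.eq_zero_or_pos m with rfl | hm
  · right; simp
  · left
    exact ⟨m, _, hm, (OrderEmbedding.card_le e).trans h2,
      fun i => (hG _ (h3 _)).resolve_right (he i), h4.comp_filter e S, rfl⟩

/-- Restriction preserves each construction once vanished terms are dropped: an average of size `n`
may have fewer than `n` terms, and a subfamily of an admissible, very fast growing family has the
same properties. -/
theorem filter_mem_W01 (S : ℕ+ → Prop) [DecidablePred S] {f : C00} (hf : f ∈ W01) :
    f.filter S ∈ W01 ∨ f.filter S = 0 := by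
  refine W01_induction (P := fun f => f.filter S ∈ W01 ∨ f.filter S = 0) (fun f _ h => ?_)
    (fun i => ?_) (fun n a ha => ?_) (fun f hf => ?_) hf
  · rw [Finsupp.filter_neg]
    exact h.imp (isSaturated_W01.neg_mem _) fun h => by rw [h, neg_zero]
  · by_cases h : S i
    · rw [Finsupp.filter_single_of_pos _ h]
      exact Or.inl (isSaturated_W01.unit_mem i)
    · exact Or.inr (Finsupp.filter_single_of_neg _ h)
  · exact (ha.filter S fun _ h => h.2).imp_left (isSaturated_W01.average_mem _ _)
  · obtain ⟨k, a, s, h1, h2, h3, h4, rfl⟩ := hf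
    obtain ⟨m, e, he, hsum⟩ := exists_orderEmb_nonzero fun i => (a i).filter S
    rw [Finsupp.filter_smul, Finsupp.filter_sum, hsum]
    rcases Nat.eq_zero_or_pos m with rfl | hm
    · right; simp
    left
    have h0 : ∀ q, a q ≠ 0 := fun q => (h2 q).ne_zero fun f hf => ne_zero_of_mem_W01 hf.1
    refine isSaturated_W01.schreier_mem _ ⟨m, _, fun j => s (e j), hm,
      fun j => ((h2 (e j)).filter S fun _ h => h.2).resolve_right (he j),
      ⟨h3.1.comp_filter e S, fun _ x hx => ?_⟩,
      ⟨h3.1.comp_filter e S, h4.2.1.comp e.strictMono, fun i j hij x hx => ?_⟩, rfl⟩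
    · exact (OrderEmbedding.card_le e).trans
        (h3.le_of_mem_support h0 (Finset.mem_filter.1 hx).1)
    · have hlt : e i < e j := e.lt_iff_lt.2 (Fin.lt_def.2 (by omega))
      have hlt' : (e i : ℕ) + 1 ≤ e j := hlt
      -- Growth is only assumed for neighbours; the original successor of `e i` may have been
      -- dropped, but its size is at most that of `e j`.
      let q : Fin k := ⟨(e i : ℕ) + 1, hlt'.trans_lt (e j).2⟩
      exact (h4.2.2 (e i) q rfl x (Finset.mem_filter.1 hx).1).trans_le
        (h4.2.1.monotone (show q ≤ e j from hlt'))

theorem pairing_comm (f x : C00) : pairing f x = pairing x f := by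
  rw [pairing_eq]
  exact Finset.sum_congr rfl fun i _ => mul_comm _ _

theorem pairing_smul_left (c : ℝ) (f x : C00) : pairing (c • f) x = c * pairing f x := by
  rw [pairing_comm, pairing_smul, pairing_comm x]

/-- The functional `x ↦ f(x)` on `c₀₀(ℕ)`. -/
def pairingₗ (f : C00) : C00 →ₗ[ℝ] ℝ where
  toFun := pairing f
  map_add' := pairing_add f
  map_smul' := pairing_smul f

theorem pairing_sum {ι : Type*} (s : Finset ι) (f : C00) (x : ι → C00) :
    pairing f (∑ i ∈ s, x i) = ∑ i ∈ s, pairing f (x i) :=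
  map_sum (pairingₗ f) x s

theorem pairing_sum_left {ι : Type*} (s : Finset ι) (f : ι → C00) (x : C00) :
    pairing (∑ i ∈ s, f i) x = ∑ i ∈ s, pairing (f i) x := by
  rw [pairing_comm, pairing_sum]
  exact Finset.sum_congr rfl fun i _ => pairing_comm _ _

theorem pairing_filter (S : ℕ+ → Prop) [DecidablePred S] (f x : C00) :
    pairing f (x.filter S) = pairing (f.filter S) x := by
  have h2 : pairing f (x.filter S) = ∑ i ∈ f.support, f i * x.filter S i := rfl
  have h3 : pairing (f.filter S) x = ∑ i ∈ f.support, f.filter S i * x i := by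
    refine Finset.sum_subset (Finset.filter_subset _ _) fun i _ h => ?_
    simp [Finsupp.notMem_support_iff.1 h]
  rw [h2, h3]
  refine Finset.sum_congr rfl fun i _ => ?_
  by_cases hi : S i <;> simp [hi]

theorem exists_mem_support_of_pairing_ne_zero {f x : C00} (h : pairing f x ≠ 0) :
    ∃ i, i ∈ f.support ∧ i ∈ x.support := by
  obtain ⟨i, hi, h⟩ := Finset.exists_ne_zero_of_sum_ne_zero h
  exact ⟨i, hi, Finsupp.mem_support_iff.2 (right_ne_zero_of_mul h)⟩

theorem normW_filter_le (S : ℕ+ → Prop) [DecidablePred S] (x : C00) :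
    normW (x.filter S) ≤ normW x := by
  refine normW_le fun f hf => ?_
  rw [pairing_filter]
  rcases filter_mem_W01 S hf with h | h
  · exact pairing_le_normW h x
  · simpa [h, pairing] using normW_nonneg x

/-! ### Block sequences and bounded completeness -/

/-- The support of `x` lies strictly to the right of `n`. -/
def SupportedAfter (n : ℕ) (x : C00) : Prop := ∀ i ∈ x.support, n < (i : ℕ)

theorem exists_block_sequence {P : C00 → Prop} (h : ∀ n, ∃ x, P x ∧ SupportedAfter n x) (n₀ : ℕ) :
    ∃ (p : ℕ → ℕ) (x : ℕ → C00), StrictMono p ∧ p 0 = n₀ ∧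
      ∀ j, P (x j) ∧ SupportedAfter (p j) (x j) ∧ ∀ i ∈ (x j).support, (i : ℕ) ≤ p (j + 1) := by
  choose g hg hg' using h
  let next : ℕ → ℕ := fun n => n + 1 + (g n).support.sup fun i => (i : ℕ)
  let p : ℕ → ℕ := fun j => next^[j] n₀
  have hp : ∀ j, p (j + 1) = next (p j) := fun j => Function.iterate_succ_apply' next j n₀
  refine ⟨p, fun j => g (p j), strictMono_nat_of_lt_succ fun j => ?_, rfl,
    fun j => ⟨hg _, hg' _, fun i hi => ?_⟩⟩
  · rw [hp]
    show p j < p j + 1 + _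
    omega
  · have h1 : (i : ℕ) ≤ (g (p j)).support.sup fun i => (i : ℕ) :=
      Finset.le_sup (f := fun i : ℕ+ => (i : ℕ)) hi
    rw [hp]
    show (i : ℕ) ≤ p j + 1 + _
    omega

/-- A functional on `c₀₀(ℕ)` that is bounded on the norming set is small on the elements of the
norming set with support far to the right: the basis is boundedly complete. -/
theorem exists_forall_mem_W01_le (L : C00 →ₗ[ℝ] ℝ) {C : ℝ} (hL : ∀ f ∈ W01, L f ≤ C) {δ : ℝ}
    (hδ : 0 < δ) : ∃ n, ∀ f ∈ W01, SupportedAfter n f → L f ≤ δ := by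
  by_contra! hcon
  obtain ⟨k, hk⟩ := exists_nat_gt (2 * C / δ)
  -- Starting beyond `k + 1` makes any `k + 1` successive averages of the blocks admissible.
  obtain ⟨p, f, hp, hp0, hf⟩ := exists_block_sequence (P := fun f => f ∈ W01 ∧ δ < L f)
    (fun n => by
      obtain ⟨f, h1, h2, h3⟩ := hcon n
      exact ⟨f, ⟨h1, h3⟩, h2⟩) (k + 1)
  -- The `i`-th average starts at block `t i` and uses exactly `p (t i) + 1` blocks. Earlier
  -- averages live on `{1, …, p (t i)}`, so this size is just large enough for very fast growth.
  let t : ℕ → ℕ := fun i => (fun m => m + (p m + 1))^[i] 0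
  have ht : ∀ i, t (i + 1) = t i + (p (t i) + 1) := fun i => Function.iterate_succ_apply' _ i 0
  have htm : StrictMono t := strictMono_nat_of_lt_succ fun i => by rw [ht]; omega
  let s : ℕ → ℕ := fun i => p (t i) + 1
  let a : ℕ → C00 := fun i => (1 / (s i : ℝ)) • ∑ j : Fin (s i), f (t i + j)
  have hsuccf : ∀ m l : ℕ, m < l → Before (f m) (f l) := fun m l hml x hx y hy =>
    PNat.coe_lt_coe _ _ |>.1
      ((((hf m).2.2 x hx).trans (hp.monotone hml)).trans_lt ((hf l).2.1 y hy))
  have hsupp : ∀ i, ∀ m ∈ (a i).support, p (t i) < (m : ℕ) ∧ (m : ℕ) ≤ p (t (i + 1)) := by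
    intro i m hm
    have h1 := Finsupp.support_smul hm
    obtain ⟨j, -, hj⟩ := Finset.mem_biUnion.1 (Finsupp.support_finsetSum h1)
    have hj2 := j.2
    exact ⟨(hp.monotone (Nat.le_add_right _ _)).trans_lt ((hf _).2.1 m hj),
      ((hf _).2.2 m hj).trans (hp.monotone (by rw [ht]; show t i + j + 1 ≤ t i + s i; omega))⟩
  have havg : ∀ i, IsAlphaAverage W01 (s i) (a i) := fun i =>
    ⟨s i, fun j => f (t i + j), by simp [s], le_rfl, fun j => (hf _).1.1,
      fun j l hjl => hsuccf _ _ (by simpa using hjl), rfl⟩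
  have hLa : ∀ i, δ ≤ L (a i) := by
    intro i
    have hs : (0 : ℝ) < s i := by simp only [s]; positivity
    have h1 : ∑ _j : Fin (s i), δ ≤ ∑ j : Fin (s i), L (f (t i + j)) :=
      Finset.sum_le_sum fun j _ => (hf _).1.2.le
    simp only [a, map_smul, map_sum, smul_eq_mul]
    rw [Finset.sum_const, Finset.card_univ, Fintype.card_fin, nsmul_eq_mul] at h1
    rw [one_div, le_inv_mul_iff₀ hs]
    exact h1
  have hsucc : Successive fun i : Fin (k + 1) => a i := fun i j hij x hx y hy =>
    PNat.coe_lt_coe _ _ |>.1 (((hsupp i x hx).2.trans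
      (hp.monotone (htm.monotone (Nat.succ_le_of_lt hij)))).trans_lt (hsupp j y hy).1)
  have hF : IsSchreierFunctional W01 ((1 / 2 : ℝ) • ∑ i : Fin (k + 1), a i) := by
    refine ⟨k + 1, fun i => a i, fun i => s i, by omega, fun i => havg i,
      ⟨hsucc, fun h m hm => ?_⟩, ⟨hsucc, fun i j hij => ?_, fun i j hij m hm => ?_⟩, rfl⟩
    · exact hp0 ▸ ((hp.monotone (Nat.zero_le _)).trans (hsupp 0 m hm).1.le)
    · exact Nat.succ_lt_succ (hp (htm hij))
    · show (m : ℕ) < s j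
      rw [← hij]
      exact Nat.lt_succ_of_le (hsupp i m hm).2
  have h1 := hL _ (isSaturated_W01.schreier_mem _ hF)
  have h2 : ∑ _i : Fin (k + 1), δ ≤ ∑ i : Fin (k + 1), L (a i) :=
    Finset.sum_le_sum fun i _ => hLa i
  rw [map_smul, map_sum, smul_eq_mul] at h1
  rw [Finset.sum_const, Finset.card_univ, Fintype.card_fin, nsmul_eq_mul] at h2
  rw [div_lt_iff₀ hδ] at hk
  push_cast at h2
  nlinarith

/-! ### The shrinking property -/

/-- The pairs `(q, j)` with nonzero pairing form a monotone staircase, on which `q + j` is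
injective; hence there are at most `k + N` of them, rather than `k * N`. -/
theorem sum_abs_pairing_le {k N : ℕ} {a : Fin k → C00} {x : Fin N → C00} (ha : Successive a)
    (hx : Successive x) (h : ∀ q j, |pairing (a q) (x j)| ≤ 1) :
    ∑ q, ∑ j, |pairing (a q) (x j)| ≤ k + N := by
  classical
  let T : Finset (Fin k × Fin N) := Finset.univ.filter fun r => pairing (a r.1) (x r.2) ≠ 0
  have hmono : ∀ r ∈ T, ∀ r' ∈ T, r.1 < r'.1 → r.2 ≤ r'.2 := by
    intro r hr r' hr' hlt
    obtain ⟨i, hi, hi'⟩ := exists_mem_support_of_pairing_ne_zero (Finset.mem_filter.1 hr).2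
    obtain ⟨j, hj, hj'⟩ := exists_mem_support_of_pairing_ne_zero (Finset.mem_filter.1 hr').2
    by_contra! hcon
    exact lt_asymm (ha _ _ hlt i hi j hj) (hx _ _ hcon j hj' i hi')
  have hinj : Set.InjOn (fun r : Fin k × Fin N => (r.1 : ℕ) + r.2) T := by
    intro r hr r' hr' heq
    simp only at heq
    rcases lt_trichotomy r.1 r'.1 with hlt | he | hlt
    · have := hmono r hr r' hr' hlt
      rw [Fin.lt_def] at hlt
      rw [Fin.le_def] at this
      omega
    · refine Prod.ext he (Fin.ext ?_)
      rw [he] at heq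
      omega
    · have := hmono r' hr' r hr hlt
      rw [Fin.lt_def] at hlt
      rw [Fin.le_def] at this
      omega
  have hcard : T.card ≤ k + N := by
    have := Finset.card_le_card_of_injOn (t := Finset.range (k + N)) _
      (fun r _ => by
        have h1 := r.1.2
        have h2 := r.2.2
        simp only [Finset.coe_range, Set.mem_Iio]
        omega) hinj
    simpa using this
  calc ∑ q, ∑ j, |pairing (a q) (x j)|
      = ∑ r : Fin k × Fin N, |pairing (a r.1) (x r.2)| := (Fintype.sum_prod_type' _).symm
    _ = ∑ r ∈ T, |pairing (a r.1) (x r.2)| := by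
        refine (Finset.sum_subset (Finset.subset_univ T) fun r _ hr => ?_).symm
        have : pairing (a r.1) (x r.2) = 0 := by
          by_contra hne
          exact hr (Finset.mem_filter.2 ⟨Finset.mem_univ _, hne⟩)
        rw [this, abs_zero]
    _ ≤ ∑ _r ∈ T, (1 : ℝ) := Finset.sum_le_sum fun r _ => h _ _
    _ ≤ k + N := by
        rw [Finset.sum_const, nsmul_eq_mul, mul_one]
        exact_mod_cast hcard

theorem IsAlphaAverage.abs_pairing_le {G : Set C00} {x : C00} {c : ℝ}
    (hG : ∀ f ∈ G, |pairing f x| ≤ c) {n : ℕ} {a : C00} (ha : IsAlphaAverage G n a) :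
    |pairing a x| ≤ c := by
  obtain ⟨d, f, h1, h2, h3, -, rfl⟩ := ha
  have hn : (0 : ℝ) < n := Nat.cast_pos.2 (by omega)
  have hc : 0 ≤ c := (abs_nonneg _).trans (hG _ (h3 ⟨0, h1⟩))
  have h4 : |∑ i, pairing (f i) x| ≤ ∑ _i : Fin d, c :=
    (Finset.abs_sum_le_sum_abs _ _).trans (Finset.sum_le_sum fun i _ => hG _ (h3 i))
  rw [Finset.sum_const, Finset.card_univ, Fintype.card_fin, nsmul_eq_mul] at h4
  rw [pairing_smul_left, pairing_sum_left, abs_mul, abs_of_nonneg (by positivity), one_div,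
    inv_mul_le_iff₀ hn]
  exact h4.trans (mul_le_mul_of_nonneg_right (by exact_mod_cast h2) hc)

theorem abs_pairing_average_le {N : ℕ} (hN : 0 < N) {y : Fin N → C00} {f : C00} {c : ℝ}
    (h : ∑ j, |pairing f (y j)| ≤ c) : |pairing f ((1 / (N : ℝ)) • ∑ j, y j)| ≤ c / N := by
  have hN' : (0 : ℝ) < N := Nat.cast_pos.2 hN
  rw [pairing_smul, pairing_sum, abs_mul, abs_of_nonneg (by positivity), one_div, inv_mul_eq_div]
  exact div_le_div_of_nonneg_right ((Finset.abs_sum_le_sum_abs _ _).trans h) hN'.le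

/-- The `ℓ₁`-behaviour of a block sequence in the unit ball is not almost isometric. -/
theorem normW_add_average_le {x : C00} {N M : ℕ} {y : Fin N → C00} (hx : normW x ≤ 1)
    (hxM : ∀ i ∈ x.support, (i : ℕ) ≤ M) (hM : 0 < M) (hN : N = 2 * M) (hy : ∀ j, normW (y j) ≤ 1)
    (hys : Successive y) (hxy : ∀ j, Before x (y j)) :
    normW (x + (1 / (N : ℝ)) • ∑ j, y j) ≤ 7 / 4 := by
  have hN0 : 0 < N := by omega
  have hN' : (0 : ℝ) < N := Nat.cast_pos.2 hN0
  have hpx : ∀ f ∈ W01, |pairing f x| ≤ 1 := fun f hf => (abs_pairing_le_normW hf x).trans hx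
  have hpy : ∀ f ∈ W01, ∀ j, |pairing f (y j)| ≤ 1 := fun f hf j =>
    (abs_pairing_le_normW hf _).trans (hy j)
  have hpav : ∀ f ∈ W01, |pairing f ((1 / (N : ℝ)) • ∑ j, y j)| ≤ 1 := fun f hf => by
    have h := abs_pairing_average_le hN0 (f := f) (y := y)
      (Finset.sum_le_sum fun j _ => hpy f hf j)
    simpa [hN'.ne'] using h
  have hzero : ∀ f ∈ W01, pairing f x = 0 →
      |pairing f (x + (1 / (N : ℝ)) • ∑ j, y j)| ≤ 7 / 4 := fun f hf h0 => by
    rw [pairing_add, h0, zero_add]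
    exact (hpav f hf).trans (by norm_num)
  refine normW_le fun f hf => (le_abs_self _).trans ?_
  -- Averages inherit the bound by convexity, and a unit vector that meets `x` misses every `y j`;
  -- only Schreier functionals need work.
  refine W01_induction (P := fun f => |pairing f (x + (1 / (N : ℝ)) • ∑ j, y j)| ≤ 7 / 4)
    (fun f _ h => ?_) (fun i => ?_) (fun n a ha => ha.abs_pairing_le fun _ h => h.2)
    (fun f hfs => ?_) hf
  · rwa [pairing_neg_left, abs_neg]
  · by_cases h0 : pairing (Finsupp.single i 1) x = 0
    · exact hzero _ (isSaturated_W01.unit_mem i) h0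
    have h1 : ∀ j, pairing (Finsupp.single i 1) (y j) = 0 := by
      intro j
      by_contra hne
      obtain ⟨m, hm, hm'⟩ := exists_mem_support_of_pairing_ne_zero h0
      obtain ⟨l, hl, hl'⟩ := exists_mem_support_of_pairing_ne_zero hne
      have hmi := Finset.mem_singleton.1 (Finsupp.support_single_subset hm)
      have hli := Finset.mem_singleton.1 (Finsupp.support_single_subset hl)
      have := hxy j m hm' l hl'
      rw [hmi, hli] at this
      exact lt_irrefl _ this
    rw [pairing_add, pairing_smul, pairing_sum, Finset.sum_eq_zero fun j _ => h1 j, mul_zero,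
      add_zero]
    exact (hpx _ (isSaturated_W01.unit_mem i)).trans (by norm_num)
  · have hfW : f ∈ W01 := isSaturated_W01.schreier_mem f (hfs.mono fun _ h => h.1)
    by_cases h0 : pairing f x = 0
    · exact hzero f hfW h0
    obtain ⟨k, a, s, h1, h2, h3, h4, rfl⟩ := hfs
    have haW : ∀ q, a q ∈ W01 := fun q =>
      isSaturated_W01.average_mem _ _ ((h2 q).mono fun _ h => h.1)
    obtain ⟨i, hi, hix⟩ := exists_mem_support_of_pairing_ne_zero h0
    obtain ⟨q, -, hq⟩ := Finset.mem_biUnion.1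
      (Finsupp.support_finsetSum (Finsupp.support_smul hi))
    have hkM : k ≤ M :=
      (h3.le_of_mem_support (fun q => ne_zero_of_mem_W01 (haW q)) hq).trans (hxM i hix)
    have hsum : ∑ j, |pairing ((1 / 2 : ℝ) • ∑ q, a q) (y j)| ≤ 1 / 2 * (k + N) := by
      refine le_trans ?_ (mul_le_mul_of_nonneg_left
        (sum_abs_pairing_le h3.1 hys fun q j => hpy _ (haW q) j) (by norm_num))
      rw [Finset.sum_comm, Finset.mul_sum]
      refine Finset.sum_le_sum fun j _ => ?_
      rw [pairing_smul_left, pairing_sum_left, abs_mul, abs_of_nonneg (by norm_num)]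
      exact mul_le_mul_of_nonneg_left (Finset.abs_sum_le_sum_abs _ _) (by norm_num)
    have hav := abs_pairing_average_le hN0 hsum
    -- Here `k ≤ M` and `N = 2 * M` give `k / N ≤ 1 / 2`.
    have hk34 : 1 / 2 * ((k : ℝ) + N) / N ≤ 3 / 4 := by
      rw [div_le_iff₀ hN']
      have : (2 : ℝ) * k ≤ N := by exact_mod_cast (by omega : 2 * k ≤ N)
      linarith
    rw [pairing_add]
    refine (abs_add_le _ _).trans ?_
    linarith [hpx _ hfW]

/-- A bounded functional on `c₀₀(ℕ)` is small on the vectors with support far to the right: the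
basis is shrinking. -/
theorem exists_forall_abs_le (L : C00 →ₗ[ℝ] ℝ) {C : ℝ} (hL : ∀ x, |L x| ≤ C * normW x) {ε : ℝ}
    (hε : 0 < ε) : ∃ n, ∀ x, SupportedAfter n x → |L x| ≤ ε * normW x := by
  by_contra! hcon
  let A : Set ℝ := {c | ∃ n, ∀ x, SupportedAfter n x → |L x| ≤ c * normW x}
  have hAε : ∀ c ∈ A, ε ≤ c := by
    rintro c ⟨n, hn⟩
    obtain ⟨x, hx, hlt⟩ := hcon n
    by_contra! h
    exact absurd (hn x hx)
      (not_le.2 ((mul_le_mul_of_nonneg_right h.le (normW_nonneg x)).trans_lt hlt))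
  have hAne : A.Nonempty := ⟨C, 0, fun x _ => hL x⟩
  have hAbdd : BddBelow A := ⟨ε, hAε⟩
  have hθ : 0 < sInf A := hε.trans_le (le_csInf hAne hAε)
  -- The constants `33/32` and, below, `31/32` only need to satisfy `7/4 * 33/32 < 2 * 31/32`.
  obtain ⟨c, ⟨n₀, hn₀⟩, hc⟩ := exists_lt_of_csInf_lt hAne
    (show sInf A < 33 / 32 * sInf A by linarith)
  have hc0 : 0 < c := hθ.trans_le (csInf_le hAbdd ⟨n₀, hn₀⟩)
  have hex : ∀ n, ∃ x, (normW x ≤ 1 ∧ 31 / 32 * sInf A < L x) ∧ SupportedAfter n x := by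
    intro n
    have hnot : 31 / 32 * sInf A ∉ A := fun h => by linarith [csInf_le hAbdd h]
    obtain ⟨x, hx, hlt⟩ : ∃ x, SupportedAfter n x ∧ 31 / 32 * sInf A * normW x < |L x| := by
      by_contra! h
      exact hnot ⟨n, h⟩
    have hpos : 0 < normW x := by
      refine (normW_nonneg x).lt_of_ne' fun h0 => ?_
      rw [eq_zero_of_normW h0] at hlt
      simp only [map_zero, abs_zero] at hlt
      nlinarith [normW_nonneg 0]
    obtain ⟨σ, hσ, hσL⟩ : ∃ σ : ℝ, |σ| = 1 ∧ σ * L x = |L x| := by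
      rcases le_total 0 (L x) with h | h
      · exact ⟨1, abs_one, by rw [one_mul, abs_of_nonneg h]⟩
      · exact ⟨-1, by simp, by rw [abs_of_nonpos h]; ring⟩
    refine ⟨(σ * (normW x)⁻¹) • x, ⟨?_, ?_⟩, fun i hi => hx i (Finsupp.support_smul hi)⟩
    · rw [normW_smul, abs_mul, hσ, abs_inv, abs_of_pos hpos, one_mul, inv_mul_cancel₀ hpos.ne']
    · rw [map_smul, smul_eq_mul, mul_right_comm, hσL, ← div_eq_mul_inv, lt_div_iff₀ hpos]
      exact hlt
  obtain ⟨p, x, hp, hp0, hx⟩ := exists_block_sequence hex n₀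
  have hbefore : ∀ m l : ℕ, m < l → Before (x m) (x l) := fun m l hml i hi j hj =>
    PNat.coe_lt_coe _ _ |>.1
      ((((hx m).2.2 i hi).trans (hp.monotone hml)).trans_lt ((hx l).2.1 j hj))
  have hM : 0 < p 1 := (Nat.zero_le _).trans_lt (hp Nat.zero_lt_one)
  obtain ⟨N, hN⟩ : ∃ N, N = 2 * p 1 := ⟨_, rfl⟩
  have hN0 : (0 : ℝ) < N := Nat.cast_pos.2 (by omega)
  let y : Fin N → C00 := fun j => x (j + 1)
  have hnorm : normW (x 0 + (1 / (N : ℝ)) • ∑ j, y j) ≤ 7 / 4 :=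
    normW_add_average_le (hx 0).1.1 (hx 0).2.2 hM hN (fun j => (hx _).1.1)
      (fun i j hij => hbefore _ _ (by simpa using hij)) fun j => hbefore _ _ (Nat.succ_pos _)
  have hafter : ∀ j, SupportedAfter n₀ (x j) := fun j i hi =>
    (hp0 ▸ hp.monotone (Nat.zero_le j)).trans_lt ((hx j).2.1 i hi)
  have hsupp : SupportedAfter n₀ (x 0 + (1 / (N : ℝ)) • ∑ j, y j) := by
    classical
    intro i hi
    rcases Finset.mem_union.1 (Finsupp.support_add hi) with h | h
    · exact hafter 0 i h
    · obtain ⟨j, -, hj⟩ := Finset.mem_biUnion.1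
        (Finsupp.support_finsetSum (Finsupp.support_smul h))
      exact hafter _ i hj
  have hup := (le_abs_self _).trans (hn₀ _ hsupp)
  have hlow : 31 / 32 * sInf A ≤ L ((1 / (N : ℝ)) • ∑ j, y j) := by
    have h1 : ∑ _j : Fin N, 31 / 32 * sInf A ≤ ∑ j, L (y j) :=
      Finset.sum_le_sum fun j _ => (hx _).1.2.le
    rw [Finset.sum_const, Finset.card_univ, Fintype.card_fin, nsmul_eq_mul] at h1
    rw [map_smul, map_sum, smul_eq_mul, one_div, le_inv_mul_iff₀ hN0]
    exact h1
  rw [map_add] at hup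
  have h0 := (hx 0).1.2
  have h2 := mul_le_mul_of_nonneg_left hnorm hc0.le
  linarith

/-! ### Duality on the completion and reflexivity -/

/-- The canonical embedding of `c₀₀(ℕ)` into its completion. -/
def toX : C00 →ₗ[ℝ] XHalf01 where
  toFun x := ((show NormedC00 from x : NormedC00) : XHalf01)
  map_add' x y := UniformSpace.Completion.coe_add (α := NormedC00) x y
  map_smul' c x := UniformSpace.Completion.coe_smul (X := NormedC00) c x

theorem norm_toX (x : C00) : ‖toX x‖ = normW x :=
  UniformSpace.Completion.norm_coe (E := NormedC00) x

theorem denseRange_toX : DenseRange toX :=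
  UniformSpace.Completion.denseRange_coe (α := NormedC00)

theorem exists_dual (L : C00 →ₗ[ℝ] ℝ) {C : ℝ} (hC : 0 ≤ C) (hL : ∀ x, |L x| ≤ C * normW x) :
    ∃ φ : StrongDual ℝ XHalf01, (∀ x, φ (toX x) = L x) ∧ ‖φ‖ ≤ C := by
  have h : ∀ x, ‖L x‖ ≤ C * ‖toX x‖ := fun x => by simpa [norm_toX] using hL x
  exact ⟨L.extendOfNorm toX, LinearMap.extendOfNorm_eq denseRange_toX ⟨C, h⟩,
    LinearMap.opNorm_extendOfNorm_le denseRange_toX hC h⟩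

theorem dual_ext {φ ψ : StrongDual ℝ XHalf01} (h : ∀ x, φ (toX x) = ψ (toX x)) : φ = ψ :=
  ContinuousLinearMap.ext fun z =>
    congrFun (denseRange_toX.equalizer φ.continuous ψ.continuous (funext h)) z

theorem norm_dual_le {φ : StrongDual ℝ XHalf01} {C : ℝ} (hC : 0 ≤ C)
    (h : ∀ x, |φ (toX x)| ≤ C * normW x) : ‖φ‖ ≤ C := by
  obtain ⟨ψ, hψ, hψC⟩ := exists_dual (φ.toLinearMap ∘ₗ toX) hC h
  rwa [dual_ext (φ := φ) (ψ := ψ) fun x => (hψ x).symm]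

theorem exists_coord (i : ℕ+) : ∃ φ : StrongDual ℝ XHalf01, (∀ x, φ (toX x) = x i) ∧ ‖φ‖ ≤ 1 :=
  exists_dual (Finsupp.lapply i) zero_le_one fun x => by
    simpa using abs_apply_le_normW x i

/-- The coordinate functionals on the completion. -/
def coord (i : ℕ+) : StrongDual ℝ XHalf01 := (exists_coord i).choose

theorem coord_toX (i : ℕ+) (x : C00) : coord i (toX x) = x i := (exists_coord i).choose_spec.1 x

/-- The functional on the completion given by a finitely supported sequence. -/
def dualVec : C00 →ₗ[ℝ] StrongDual ℝ XHalf01 := Finsupp.linearCombination ℝ coord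

theorem dualVec_toX (f x : C00) : dualVec f (toX x) = pairing f x := by
  simp [dualVec, Finsupp.linearCombination_apply, Finsupp.sum, pairing, coord_toX]

theorem norm_dualVec_le {f : C00} (hf : f ∈ W01) : ‖dualVec f‖ ≤ 1 :=
  norm_dual_le zero_le_one fun x => by
    rw [dualVec_toX, one_mul]
    exact abs_pairing_le_normW hf x

/-- The interval `{1, …, n}` of positive integers. -/
def initialSegment (n : ℕ) : Finset ℕ+ := (Finset.univ : Finset (Fin n)).image fun i => i.1.succPNat

theorem mem_initialSegment {n : ℕ} {i : ℕ+} : i ∈ initialSegment n ↔ (i : ℕ) ≤ n := by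
  simp only [initialSegment, Finset.mem_image, Finset.mem_univ, true_and]
  constructor
  · rintro ⟨j, rfl⟩
    exact j.2
  · intro h
    have := i.pos
    exact ⟨⟨(i : ℕ) - 1, by omega⟩, PNat.eq (by simp; omega)⟩

/-- The truncation of a sequence to `{1, …, n}`. -/
def truncate (a : ℕ+ → ℝ) (n : ℕ) : C00 := ∑ i ∈ initialSegment n, Finsupp.single i (a i)

theorem truncate_apply (a : ℕ+ → ℝ) (n : ℕ) (i : ℕ+) :
    truncate a n i = if (i : ℕ) ≤ n then a i else 0 := by
  classical
  simp [truncate, Finsupp.finsetSum_apply, Finsupp.single_apply, mem_initialSegment]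

/-- Cutting `φ` off at `n` leaves an error that sees only the part of `x` beyond `n`, where the
shrinking property applies. -/
theorem exists_norm_sub_dualVec_le (φ : StrongDual ℝ XHalf01) {ε : ℝ} (hε : 0 < ε) :
    ∃ f, ‖φ - dualVec f‖ ≤ ε := by
  obtain ⟨n, hn⟩ := exists_forall_abs_le (φ.toLinearMap ∘ₗ toX) (C := ‖φ‖)
    (fun x => by simpa [norm_toX] using φ.le_opNorm (toX x)) hε
  refine ⟨truncate (fun i => φ (toX (Finsupp.single i 1))) n, norm_dual_le hε.le fun x => ?_⟩
  have h1 : pairing (truncate (fun i => φ (toX (Finsupp.single i 1))) n) x =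
      φ (toX (x.filter fun i => (i : ℕ) ≤ n)) := by
    rw [pairing_eq, Finsupp.filter_eq_sum, map_sum, map_sum, Finsupp.sum, Finset.sum_filter]
    refine Finset.sum_congr rfl fun i _ => ?_
    rw [truncate_apply]
    split_ifs
    · rw [← mul_one (x i), ← smul_eq_mul (x i), ← Finsupp.smul_single, map_smul, map_smul,
        smul_eq_mul, smul_eq_mul, mul_one, mul_comm]
    · rw [zero_mul]
  have h2 : (φ - dualVec (truncate (fun i => φ (toX (Finsupp.single i 1))) n)) (toX x) =
      φ (toX (x.filter fun i => ¬ (i : ℕ) ≤ n)) := by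
    rw [sub_apply, dualVec_toX, h1, sub_eq_iff_eq_add', ← map_add, ← map_add,
      Finsupp.filter_add_filter_not]
  rw [h2]
  refine (hn _ fun i hi => ?_).trans ?_
  · rw [Finsupp.support_filter, Finset.mem_filter] at hi
    exact not_le.1 hi.2
  exact mul_le_mul_of_nonneg_left (normW_filter_le _ x) hε.le

theorem pairing_truncate_sub (Φ : StrongDual ℝ (StrongDual ℝ XHalf01)) (f : C00) {m n : ℕ}
    (hmn : m ≤ n) : pairing f (truncate (fun i => Φ (coord i)) n -
      truncate (fun i => Φ (coord i)) m) =
        Φ (dualVec (f.filter fun i => m < (i : ℕ) ∧ (i : ℕ) ≤ n)) := by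
  rw [Finsupp.filter_eq_sum, map_sum, map_sum, pairing, Finsupp.sum, Finset.sum_filter]
  refine Finset.sum_congr rfl fun i _ => ?_
  rw [Finsupp.sub_apply, truncate_apply, truncate_apply, dualVec,
    Finsupp.linearCombination_single, map_smul, smul_eq_mul]
  by_cases h1 : (i : ℕ) ≤ m
  · simp [h1, h1.trans hmn]
  · by_cases h2 : (i : ℕ) ≤ n <;> simp [h1, h2, not_le.1]

/-- A norming functional evaluated on a difference of truncations is `Φ` at its restriction to an
interval. That restriction is zero or again in `W01`, so bounded completeness bounds it uniformly.
-/
theorem cauchySeq_truncate (Φ : StrongDual ℝ (StrongDual ℝ XHalf01)) :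
    CauchySeq fun n => toX (truncate (fun i => Φ (coord i)) n) := by
  refine Metric.cauchySeq_iff'.2 fun ε hε => ?_
  obtain ⟨m, hm⟩ := exists_forall_mem_W01_le (Φ.toLinearMap ∘ₗ dualVec) (C := ‖Φ‖)
    (fun f hf => (le_abs_self _).trans ((Φ.le_opNorm _).trans
      (mul_le_of_le_one_right (norm_nonneg _) (norm_dualVec_le hf)))) (half_pos hε)
  refine ⟨m, fun n hn => ?_⟩
  rw [dist_eq_norm, ← map_sub, norm_toX]
  refine lt_of_le_of_lt (normW_le fun f hf => ?_) (half_lt_self hε)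
  rw [pairing_truncate_sub Φ f hn]
  rcases filter_mem_W01 (fun i : ℕ+ => m < (i : ℕ) ∧ (i : ℕ) ≤ n) hf with h | h
  · exact hm _ h fun i hi => (Finset.mem_filter.1 hi).2.1
  · rw [h, map_zero, map_zero]
    exact (half_pos hε).le

theorem isReflexiveSpace_XHalf01 : IsReflexiveSpace XHalf01 := by
  intro Φ
  obtain ⟨z, hz⟩ := cauchySeq_tendsto_of_complete (cauchySeq_truncate Φ)
  have hcoord : ∀ i, coord i z = Φ (coord i) := fun i => by
    refine tendsto_nhds_unique (((coord i).continuous.tendsto z).comp hz)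
      (tendsto_const_nhds.congr' ?_)
    filter_upwards [eventually_ge_atTop (i : ℕ)] with n hn
    simp [coord_toX, truncate_apply, hn]
  have hvec : ∀ f, dualVec f z = Φ (dualVec f) := fun f => by
    simp [dualVec, Finsupp.linearCombination_apply, Finsupp.sum, hcoord]
  have hdense : DenseRange dualVec := fun φ => Metric.mem_closure_iff.2 fun ε hε => by
    obtain ⟨f, hf⟩ := exists_norm_sub_dualVec_le φ (half_pos hε)
    exact ⟨_, ⟨f, rfl⟩, by rw [dist_eq_norm]; exact hf.trans_lt (half_lt_self hε)⟩
  exact ⟨z, ContinuousLinearMap.ext fun φ => congrFun (hdense.equalizer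
    (NormedSpace.inclusionInDoubleDual ℝ XHalf01 z).continuous Φ.continuous (funext hvec)) φ⟩

end SpreadingSpace

end

theorem mainTheorem6 : IsReflexiveSpace SpreadingSpace.XHalf01 :=
  SpreadingSpace.isReflexiveSpace_XHalf01
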